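/- A Rademacher variable takes each of the values $+1$ and $-1$ with probability $\frac12$. A symmetric random walk of length $n$ is a sum of $n$ i.i.d. Rademacher variables. For $p \in [0,1]$ and $q \in (0,1)$ let $$D(p\|q) = p \ln\frac{p}{q} + (1-p)\ln\frac{1-p}{1-q}$$ (with $0\ln 0 = 0$), and define $\psi : [-\frac12,\frac12] \to \mathbb{R}$ by $$\psi(x) = \frac{D\left(\frac12 + x \,\middle\|\, \frac12\right)}{2x^2} \quad (x \neq 0), \qquad \psi(0) = 1.$$ For integers $n \ge 7$ and $d \ge 2$ with $d \le \exp(n/3)$ put $$L(n,d) = \frac{1 - \exp\left(-\frac{\sqrt{\ln d}}{3.1\sqrt{2\pi}}\right)}{\sqrt{\psi\left(\frac{1.6\sqrt{\ln d}}{2\sqrt n}\right)}}\, \sqrt n \left(\sqrt{2\ln d - 2\ln\ln d} - 1\right) - \sqrt n .$$ \textbf{Theorem} (Lower Bound on Maximum of Independent Symmetric Random Walks). Let $n \ge 7$ and $2 \le d \le \exp(n/3)$ be integers, and let $Z_1, \dots, Z_d$ be independent symmetric random walks of length $n$. Then $$\mathbb{E}\left[\max_{1 \le i \le d} Z_i\right]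 \;\ge\; L(n,d) \;\ge\; 0.09\sqrt{n \ln d} - 2\sqrt n .$$ Moreover, the bound $L(n,d)$ is asymptotically $\sqrt{2 n \ln d}$, in the sense that for each fixed $d \ge 2$ the limit $\lim_{n\to\infty} L(n,d)/\sqrt{2 n \ln d}$ exists, and $$\lim_{d\to\infty}\,\lim_{n\to\infty} \frac{L(n,d)}{\sqrt{2 n \ln d}} = 1 .$$ -/

import Mathlib

open MeasureTheory ProbabilityTheory Filter Topology

/-- `D(p ‖ q)`: the Kullback-Leibler divergence, in nats, between the Bernoulli distributions with
parameters `p` and `q`, where `p ∈ [0, 1]` and `q ∈ (0, 1)`. As `0 * Real.log 0 = 0`, the usual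
convention `0 ln 0 = 0` holds at the endpoints `p = 0` and `p = 1`. -/
noncomputable def bernoulliDiv (p q : ℝ) : ℝ :=
  p * Real.log (p / q) + (1 - p) * Real.log ((1 - p) / (1 - q))

/-- `ψ(x) = D(1/2 + x ‖ 1/2) / (2 x²)` for `x ∈ [-1/2, 1/2]`, `x ≠ 0`, with `ψ(0) = 1`
(the value that makes `ψ` continuous). Values outside `[-1/2, 1/2]` are irrelevant. -/
noncomputable def klRatio (x : ℝ) : ℝ :=
  if x = 0 then 1 else bernoulliDiv (1 / 2 + x) (1 / 2) / (2 * x ^ 2)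

/-- `Y` is a Rademacher random variable: `Pr[Y = 1] = Pr[Y = -1] = 1/2`. -/
structure IsRademacher {Ω : Type*} [MeasurableSpace Ω] (μ : Measure Ω) (Y : Ω → ℝ) : Prop where
  measurable : Measurable Y
  prob_one : μ {ω | Y ω = 1} = 1 / 2
  prob_neg_one : μ {ω | Y ω = -1} = 1 / 2

/-- `Z` is a symmetric random walk of length `n`: the sum of `n` i.i.d. Rademacher variables. -/
def IsSymmetricRandomWalk {Ω : Type*} [MeasurableSpace Ω] (μ : Measure Ω) (n : ℕ)
    (Z : Ω → ℝ) : Prop :=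
  ∃ Y : Fin n → Ω → ℝ, (∀ j, IsRademacher μ (Y j)) ∧ iIndepFun Y μ ∧ ∀ ω, Z ω = ∑ j, Y j ω

/-- The explicit lower bound for the expected maximum of `d` walks of length `n`. -/
noncomputable def walkMaxLowerBound (n d : ℕ) : ℝ :=
  (1 - Real.exp (-(√(Real.log d) / (3.1 * √(2 * Real.pi)))))
      / √(klRatio (1.6 * √(Real.log d) / (2 * √n)))
    * √n * (√(2 * Real.log d - 2 * Real.log (Real.log d)) - 1) - √n

/-! For any threshold `t` and any single walk `Z i`, the maximum is pointwise at least `t · 1{max ≥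
t} - |Z i|`, and `E|Z i| ≤ √n`; so it suffices that the maximum reaches `t = √n (A - 1) / R` with
good probability, where `A = √(2 ln d - 2 ln ln d)` and `R = √ψ(x₀)` with `x₀` the argument of
`klRatio` in the bound. Stirling's formula bounds each binomial point probability near `t` below by
a multiple of `ln d / (d √n)` (`choose_div_two_pow_ge_log_div`). Adding these over a window of order
`√n` head counts gives a one-walk tail (`IsSymmetricRandomWalk.tail_ge`), which independence
amplifies (`one_sub_exp_le_measureReal_iSup`). This needs `ln d ≥ 6.25`; for smaller `d` the claimed
bound is nonpositive, while the expected maximum is at least `E Z i = 0`. The simplified bound and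
the limits follow from `1 ≤ R ≤ 1.3` and from `ψ → 1` at `0`. -/

/-! ### Power series and bounds for `ψ`. -/

lemma bernoulliDiv_half_add (x : ℝ) :
    bernoulliDiv (1 / 2 + x) (1 / 2) =
      ((1 + 2 * x) * Real.log (1 + 2 * x) + (1 - 2 * x) * Real.log (1 - 2 * x)) / 2 := by
  unfold bernoulliDiv
  rw [show (1 / 2 + x) / (1 / 2) = 1 + 2 * x by ring,
    show (1 - (1 / 2 + x)) / (1 - 1 / 2) = 1 - 2 * x by ring]
  ring

lemma klRatio_mul_sq (x : ℝ) : klRatio x * (2 * x ^ 2) = bernoulliDiv (1 / 2 + x) (1 / 2) := by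
  unfold klRatio
  split_ifs with h
  · rw [bernoulliDiv_half_add, h]; simp
  · field_simp

/-- With `y = 2x`, `y² ψ(x) = y (ln(1+y) - ln(1-y)) + ln(1-y²)`; the two log series combine through
`2/(2k+1) - 1/(k+1) = 1/((k+1)(2k+1))`. Nonnegative coefficients then give monotonicity and the
bounds on `ψ`. -/
lemma hasSum_klRatio {x : ℝ} (hx : |x| < 1 / 2) :
    HasSum (fun k : ℕ => (2 * x) ^ (2 * k) / (((k : ℝ) + 1) * (2 * k + 1))) (klRatio x) := by
  rcases eq_or_ne x 0 with rfl | h0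
  · have := hasSum_single (f := fun k : ℕ =>
      (2 * (0 : ℝ)) ^ (2 * k) / (((k : ℝ) + 1) * (2 * k + 1))) 0 (by
        intro k hk
        simp [hk])
    simpa [klRatio] using this
  have hy : |2 * x| < 1 := by rw [abs_mul, abs_two]; linarith
  have hlt := abs_lt.mp hy
  have hy2 : |(2 * x) ^ 2| < 1 := by
    rw [abs_pow]
    exact pow_lt_one₀ (abs_nonneg _) hy two_ne_zero
  have h1 := (Real.hasSum_log_sub_log_of_abs_lt_one hy).mul_left (2 * x)
  have h2 := Real.hasSum_pow_div_log_of_abs_lt_one hy2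
  have h3 := (h1.sub h2).div_const ((2 * x) ^ 2)
  have hne : (2 * x) ^ 2 ≠ 0 := by positivity
  have hlog : Real.log (1 - (2 * x) ^ 2) = Real.log (1 + 2 * x) + Real.log (1 - 2 * x) := by
    rw [← Real.log_mul (by linarith) (by linarith)]
    ring_nf
  refine (congrArg₂ (HasSum · ·) (funext fun k => ?_) ?_).mpr h3
  · have : ((k : ℝ) + 1) ≠ 0 := by positivity
    have : (2 * (k : ℝ) + 1) ≠ 0 := by positivity
    have : 2 * x ≠ 0 := by positivity
    generalize 2 * x = y at *
    field_simp
    ring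
  · rw [hlog, klRatio, if_neg h0, bernoulliDiv_half_add]
    field_simp
    ring

lemma one_le_klRatio {x : ℝ} (hx : |x| < 1 / 2) : 1 ≤ klRatio x := by
  have := (hasSum_klRatio hx).summable.sum_le_tsum {0} (fun k _ => by
    rw [pow_mul]; positivity)
  rw [(hasSum_klRatio hx).tsum_eq] at this
  simpa using this

lemma klRatio_le_of_le {x z : ℝ} (hx : 0 ≤ x) (hxz : x ≤ z) (hz : z < 1 / 2) :
    klRatio x ≤ klRatio z := by
  refine hasSum_le (fun k => ?_) (hasSum_klRatio (by rw [abs_of_nonneg hx]; linarith))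
    (hasSum_klRatio (by rw [abs_of_nonneg (hx.trans hxz)]; exact hz))
  gcongr

lemma klRatio_le_inv {x : ℝ} (hx : |x| < 1 / 2) : klRatio x ≤ (1 - (2 * x) ^ 2)⁻¹ := by
  have hy : |2 * x| < 1 := by rw [abs_mul, abs_two]; linarith
  have hy2 : (2 * x) ^ 2 < 1 := by rw [← sq_abs]; exact pow_lt_one₀ (abs_nonneg _) hy two_ne_zero
  refine hasSum_le (fun k => ?_) (hasSum_klRatio hx)
    (hasSum_geometric_of_lt_one (sq_nonneg (2 * x)) hy2)
  rw [pow_mul]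
  refine div_le_self (by positivity) ?_
  nlinarith [(Nat.cast_nonneg k : (0 : ℝ) ≤ k)]

lemma tendsto_klRatio_zero : Tendsto klRatio (𝓝 0) (𝓝 1) := by
  have hev : ∀ᶠ x : ℝ in 𝓝 0, |x| < 1 / 2 := by
    have : Tendsto (fun x : ℝ => |x|) (𝓝 0) (𝓝 |0|) := continuous_abs.tendsto 0
    exact this.eventually_lt_const (by norm_num)
  have hup : Tendsto (fun x : ℝ => (1 - (2 * x) ^ 2)⁻¹) (𝓝 0) (𝓝 1) := by
    have : ContinuousAt (fun x : ℝ => (1 - (2 * x) ^ 2)⁻¹) 0 :=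
      ContinuousAt.inv₀ (by fun_prop) (by norm_num)
    simpa [ContinuousAt] using this
  exact tendsto_of_tendsto_of_tendsto_of_le_of_le' tendsto_const_nhds hup
    (hev.mono fun x => one_le_klRatio) (hev.mono fun x => klRatio_le_inv)

/-- `0.462` is just above `0.8 / √3`, the largest argument allowed by `ln d ≤ n/3`, and `1.69 =
1.3²`. -/
lemma klRatio_le {x : ℝ} (hx : 0 ≤ x) (hx' : x ≤ 0.462) : klRatio x ≤ 1.69 := by
  refine (klRatio_le_of_le hx hx' (by norm_num)).trans ?_
  have h := klRatio_mul_sq 0.462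
  rw [bernoulliDiv_half_add] at h
  have h1 : Real.log (1 + 2 * 0.462) ≤ 0.6931471808 :=
    (Real.log_le_log (by norm_num) (by norm_num)).trans Real.log_two_lt_d9.le
  have h2 : Real.log (1 - 2 * 0.462) ≤ 0 := Real.log_nonpos (by norm_num) (by norm_num)
  norm_num at h h1 h2 ⊢
  linarith

/-! ### Stirling bounds for binomial coefficients. -/

/-- The Stirling sequence decreases, so it is at most its value `e / √2` at `1`. -/
lemma factorial_le_stirling {n : ℕ} (hn : n ≠ 0) :
    (n.factorial : ℝ) ≤ Real.exp 1 * √n * ((n : ℝ) / Real.exp 1) ^ n := by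
  obtain ⟨m, rfl⟩ := Nat.exists_eq_succ_of_ne_zero hn
  have h := Stirling.stirlingSeq'_antitone (Nat.zero_le m)
  simp only [Function.comp, Stirling.stirlingSeq_one] at h
  rw [Stirling.stirlingSeq, div_le_iff₀ (by positivity)] at h
  refine h.trans_eq ?_
  rw [Real.sqrt_mul (by positivity)]
  have : √2 ≠ (0 : ℝ) := by positivity
  field_simp

lemma choose_ge_stirling {n j : ℕ} (hj : 0 < j) (hjn : j < n) :
    2 * √(2 * Real.pi) / (Real.exp 1 ^ 2 * √n) * (n : ℝ) ^ n
      ≤ n.choose j * ((j : ℝ) ^ j * ((n - j : ℕ) : ℝ) ^ (n - j)) := by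
  obtain ⟨m, rfl⟩ := Nat.exists_eq_add_of_lt hjn
  set k := m + 1 with hk
  rw [show j + m + 1 = j + k by omega, Nat.add_sub_cancel_left]
  have hk0 : 0 < k := by omega
  have hj' : (0 : ℝ) < j := by exact_mod_cast hj
  have hk' : (0 : ℝ) < k := by exact_mod_cast hk0
  have hn := Stirling.le_factorial_stirling (j + k)
  have hfj := factorial_le_stirling hj.ne'
  have hfk := factorial_le_stirling hk0.ne'
  have hch : ((j + k).choose j : ℝ) * (j.factorial * k.factorial) = (j + k).factorial := by
    have := Nat.add_choose_mul_factorial_mul_factorial j k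
    rw [← mul_assoc, Nat.choose_symm_add]; exact_mod_cast this
  -- AM-GM makes the prefactor independent of `j`: `√(2πN) / (e² N/2) = 2√(2π) / (e² √N)`.
  have hamgm : √(j : ℝ) * √(k : ℝ) ≤ ((j + k : ℕ) : ℝ) / 2 := by
    have h1 := Real.sq_sqrt hj'.le
    have h2 := Real.sq_sqrt hk'.le
    push_cast
    nlinarith [sq_nonneg (√(j : ℝ) - √(k : ℝ))]
  have hE : (0 : ℝ) < Real.exp 1 := Real.exp_pos 1
  set N : ℝ := ((j + k : ℕ) : ℝ) with hN
  have hN0 : 0 < N := by rw [hN]; push_cast; positivity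
  have hprod : (j.factorial : ℝ) * k.factorial ≤
      Real.exp 1 ^ 2 * (N / 2) * ((j : ℝ) ^ j * (k : ℝ) ^ k) / Real.exp 1 ^ (j + k) := by
    calc (j.factorial : ℝ) * k.factorial
        ≤ (Real.exp 1 * √j * ((j : ℝ) / Real.exp 1) ^ j) *
          (Real.exp 1 * √k * ((k : ℝ) / Real.exp 1) ^ k) := by gcongr
      _ = Real.exp 1 ^ 2 * (√j * √k) * ((j : ℝ) ^ j * (k : ℝ) ^ k) / Real.exp 1 ^ (j + k) := by
          rw [div_pow, div_pow, pow_add (Real.exp 1)]; ring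
      _ ≤ _ := by gcongr
  have hmain : √(2 * Real.pi * N) * (N / Real.exp 1) ^ (j + k) ≤ ((j + k).choose j : ℝ) *
      (Real.exp 1 ^ 2 * (N / 2) * ((j : ℝ) ^ j * (k : ℝ) ^ k) / Real.exp 1 ^ (j + k)) := by
    refine hn.trans ?_
    rw [← hch]
    gcongr
  rw [Real.sqrt_mul (by positivity), div_pow, ← mul_div_assoc, ← mul_div_assoc,
    div_le_div_iff_of_pos_right (by positivity)] at hmain
  have hs := Real.mul_self_sqrt hN0.le
  have hsp : 0 < √N := Real.sqrt_pos.mpr hN0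
  rw [div_mul_eq_mul_div, div_le_iff₀ (by positivity)]
  refine le_of_mul_le_mul_right ?_ (show 0 < √N / 2 by positivity)
  calc 2 * √(2 * Real.pi) * N ^ (j + k) * (√N / 2) = √(2 * Real.pi) * √N * N ^ (j + k) := by ring
    _ ≤ _ := hmain
    _ = (j + k).choose j * (Real.exp 1 ^ 2 * ((√N * √N) / 2) * ((j : ℝ) ^ j * (k : ℝ) ^ k)) := by
        rw [hs]
    _ = _ := by ring

lemma exp_neg_mul_bernoulliDiv {n j : ℕ} (hj : 0 < j) (hjn : j < n) :
    Real.exp (-(n * bernoulliDiv (j / n) (1 / 2))) * ((j : ℝ) ^ j * ((n - j : ℕ) : ℝ) ^ (n - j)) =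
      (n : ℝ) ^ n / 2 ^ n := by
  obtain ⟨m, rfl⟩ := Nat.exists_eq_add_of_lt hjn
  set k := m + 1 with hk
  rw [show j + m + 1 = j + k by omega, Nat.add_sub_cancel_left]
  have hk0 : 0 < k := by omega
  have hj' : (0 : ℝ) < j := by exact_mod_cast hj
  have hk' : (0 : ℝ) < k := by exact_mod_cast hk0
  have hjk : (0 : ℝ) < j + k := by positivity
  have hlog : -(((j + k : ℕ) : ℝ) * bernoulliDiv (j / ((j + k : ℕ) : ℝ)) (1 / 2)) =
      (j + k) * Real.log (j + k) - (j + k) * Real.log 2 - j * Real.log j - k * Real.log k := by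
    unfold bernoulliDiv
    rw [show (1 - (j : ℝ) / ((j + k : ℕ) : ℝ)) / (1 - 1 / 2) = k * 2 / (j + k) by
        push_cast; field_simp; ring,
      show (j : ℝ) / ((j + k : ℕ) : ℝ) / (1 / 2) = j * 2 / (j + k) by push_cast; field_simp,
      Real.log_div (by positivity) (by positivity), Real.log_div (by positivity) (by positivity),
      Real.log_mul (by positivity) (by positivity), Real.log_mul (by positivity) (by positivity)]
    push_cast
    field_simp
    ring
  rw [hlog]
  have hpow : ∀ (a : ℕ) (x : ℝ), 0 < x → x ^ a = Real.exp (a * Real.log x) := fun a x hx => by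
    rw [mul_comm, ← Real.rpow_def_of_pos hx, Real.rpow_natCast]
  rw [hpow j j hj', hpow k k hk', hpow _ ((j + k : ℕ) : ℝ) (by push_cast; exact hjk),
    hpow _ 2 two_pos, ← Real.exp_sub, ← Real.exp_add, ← Real.exp_add]
  push_cast
  ring_nf

/-- Lower bound for the symmetric binomial point probabilities. -/
lemma choose_div_two_pow_ge {n j : ℕ} (hj : 0 < j) (hjn : j < n) :
    2 * √(2 * Real.pi) / (Real.exp 1 ^ 2 * √n) * Real.exp (-(n * bernoulliDiv (j / n) (1 / 2)))
      ≤ n.choose j / 2 ^ n := by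
  have h1 := choose_ge_stirling hj hjn
  have h2 := exp_neg_mul_bernoulliDiv hj hjn
  have hj' : (0 : ℝ) < j := by exact_mod_cast hj
  have hk' : (0 : ℝ) < ((n - j : ℕ) : ℝ) := by exact_mod_cast Nat.sub_pos_of_lt hjn
  set Q := (j : ℝ) ^ j * ((n - j : ℕ) : ℝ) ^ (n - j) with hQ
  have hQ0 : 0 < Q := by positivity
  rw [← eq_div_iff hQ0.ne'] at h2
  rw [h2, div_div, ← mul_div_assoc, div_le_div_iff₀ (by positivity) (by positivity)]
  calc _ = 2 * √(2 * Real.pi) / (Real.exp 1 ^ 2 * √n) * (n : ℝ) ^ n * 2 ^ n := rfl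
    _ ≤ _ := mul_le_mul_of_nonneg_right h1 (by positivity)
    _ = _ := by ring

/-! ### Moments and tails of a single walk. -/

namespace IsRademacher

variable {Ω : Type*} [MeasurableSpace Ω] {μ : Measure Ω} {Y : Ω → ℝ}

lemma ae_eq_one_or [IsProbabilityMeasure μ] (h : IsRademacher μ Y) :
    ∀ᵐ ω ∂μ, Y ω = 1 ∨ Y ω = -1 := by
  have m1 : MeasurableSet {ω | Y ω = 1} := h.measurable (measurableSet_singleton 1)
  have m2 : MeasurableSet {ω | Y ω = -1} := h.measurable (measurableSet_singleton (-1))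
  have hd : Disjoint {ω | Y ω = 1} {ω | Y ω = -1} := by
    rw [Set.disjoint_left]
    intro ω h1 h2
    simp only [Set.mem_ofPred_eq] at h1 h2
    linarith
  have hu : μ ({ω | Y ω = 1} ∪ {ω | Y ω = -1}) = 1 := by
    rw [measure_union hd m2, h.prob_one, h.prob_neg_one, ENNReal.add_halves]
  exact (prob_compl_eq_zero_iff (m1.union m2)).mpr hu

lemma ae_abs_eq_one [IsProbabilityMeasure μ] (h : IsRademacher μ Y) : ∀ᵐ ω ∂μ, |Y ω| = 1 := by
  filter_upwards [h.ae_eq_one_or] with ω hω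
  rcases hω with hω | hω <;> simp [hω]

lemma memLp [IsProbabilityMeasure μ] (h : IsRademacher μ Y) (p : ENNReal) : MemLp Y p μ :=
  MemLp.of_bound h.measurable.aestronglyMeasurable 1
    (h.ae_abs_eq_one.mono fun ω hω => by rw [Real.norm_eq_abs, hω])

lemma integral_eq_zero [IsProbabilityMeasure μ] (h : IsRademacher μ Y) : ∫ ω, Y ω ∂μ = 0 := by
  have m1 : MeasurableSet {ω | Y ω = 1} := h.measurable (measurableSet_singleton 1)
  have m2 : MeasurableSet {ω | Y ω = -1} := h.measurable (measurableSet_singleton (-1))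
  have hY : Y =ᵐ[μ] fun ω => Set.indicator {ω | Y ω = 1} (fun _ => (1 : ℝ)) ω
      - Set.indicator {ω | Y ω = -1} (fun _ => (1 : ℝ)) ω := by
    filter_upwards [h.ae_eq_one_or] with ω hω
    rcases hω with hω | hω
    · simp only [Set.indicator, Set.mem_ofPred_eq, hω]; norm_num
    · simp only [Set.indicator, Set.mem_ofPred_eq, hω]; norm_num
  rw [integral_congr_ae hY, integral_sub ((integrable_const _).indicator m1)
    ((integrable_const _).indicator m2), integral_indicator m1, integral_indicator m2]
  simp [Measure.real, h.prob_one, h.prob_neg_one]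

lemma variance_eq_one [IsProbabilityMeasure μ] (h : IsRademacher μ Y) :
    variance Y μ = 1 := by
  rw [variance_of_integral_eq_zero h.measurable.aemeasurable h.integral_eq_zero]
  have : (fun ω => Y ω ^ 2) =ᵐ[μ] fun _ => (1 : ℝ) := by
    filter_upwards [h.ae_abs_eq_one] with ω hω
    rw [← sq_abs, hω, one_pow]
  rw [integral_congr_ae this]
  simp

end IsRademacher

namespace IsSymmetricRandomWalk

variable {Ω : Type*} [MeasurableSpace Ω] {μ : Measure Ω} {n : ℕ} {Z : Ω → ℝ}

lemma measurable (h : IsSymmetricRandomWalk μ n Z) : Measurable Z := by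
  obtain ⟨Y, hY, -, hZ⟩ := h
  rw [funext hZ]
  exact Finset.measurable_fun_sum _ fun j _ => (hY j).measurable

lemma memLp [IsProbabilityMeasure μ] (h : IsSymmetricRandomWalk μ n Z) (p : ENNReal) :
    MemLp Z p μ := by
  obtain ⟨Y, hY, -, hZ⟩ := h
  rw [funext hZ]
  exact memLp_finsetSum _ fun j _ => (hY j).memLp p

lemma integrable [IsProbabilityMeasure μ] (h : IsSymmetricRandomWalk μ n Z) : Integrable Z μ :=
  memLp_one_iff_integrable.mp (h.memLp 1)

lemma integral_eq_zero [IsProbabilityMeasure μ] (h : IsSymmetricRandomWalk μ n Z) :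
    ∫ ω, Z ω ∂μ = 0 := by
  obtain ⟨Y, hY, -, hZ⟩ := h
  rw [funext hZ, integral_finsetSum _ fun j _ => memLp_one_iff_integrable.mp ((hY j).memLp 1)]
  exact Finset.sum_eq_zero fun j _ => (hY j).integral_eq_zero

lemma integral_sq [IsProbabilityMeasure μ] (h : IsSymmetricRandomWalk μ n Z) :
    ∫ ω, Z ω ^ 2 ∂μ = n := by
  rw [← variance_of_integral_eq_zero h.measurable.aemeasurable h.integral_eq_zero]
  obtain ⟨Y, hY, hind, hZ⟩ := h
  have hZ' : Z = ∑ j, Y j := by ext ω; simp [hZ]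
  rw [hZ', IndepFun.variance_sum (fun j _ => (hY j).memLp 2)
    (fun i _ j _ hij => hind.indepFun hij), Finset.sum_congr rfl fun j _ => (hY j).variance_eq_one]
  simp

lemma integral_abs_le [IsProbabilityMeasure μ] (h : IsSymmetricRandomWalk μ n Z) (hn : 0 < n) :
    ∫ ω, |Z ω| ∂μ ≤ √n := by
  have hs : 0 < √(n : ℝ) := Real.sqrt_pos.mpr (by exact_mod_cast hn)
  have hsq := Real.mul_self_sqrt (Nat.cast_nonneg (α := ℝ) n)
  calc ∫ ω, |Z ω| ∂μ ≤ ∫ ω, (Z ω ^ 2 / (2 * √n) + √n / 2) ∂μ := by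
        refine integral_mono h.integrable.abs
          ((((h.memLp 2).integrable_sq).div_const _).add (integrable_const _)) fun ω => ?_
        -- Pointwise AM-GM with weight `√n` replaces Cauchy–Schwarz.
        have : Z ω ^ 2 / (2 * √n) + √n / 2 - |Z ω| = (|Z ω| - √n) ^ 2 / (2 * √n) := by
          rw [← sq_abs]; field_simp; ring
        have h2 : 0 ≤ (|Z ω| - √n) ^ 2 / (2 * √n) := by positivity
        show |Z ω| ≤ Z ω ^ 2 / (2 * √n) + √n / 2
        linarith
    _ = √n := by
        rw [integral_add (((h.memLp 2).integrable_sq).div_const _) (integrable_const _),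
          integral_div, h.integral_sq, integral_const]
        simp only [probReal_univ, smul_eq_mul, one_mul]
        field_simp
        nlinarith

/-- A set of head counts whose walks all reach `t` bounds the upper tail from below. -/
lemma sum_choose_le_measureReal [IsProbabilityMeasure μ] (h : IsSymmetricRandomWalk μ n Z) {t : ℝ}
    {J : Finset ℕ} (hJ : ∀ j ∈ J, t ≤ 2 * j - n) :
    ∑ j ∈ J, (n.choose j / 2 ^ n : ℝ) ≤ μ.real {ω | t ≤ Z ω} := by
  obtain ⟨Y, hY, hind, hZ⟩ := h
  set s : Finset (Fin n) → Fin n → ℝ := fun S i => if i ∈ S then 1 else -1 with hs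
  -- `E S` is the event that the `+1` steps are exactly those in `S` and all others are `-1`. These
  -- events are disjoint, each of probability `2⁻ⁿ`.
  set E : Finset (Fin n) → Set Ω := fun S => ⋂ i, Y i ⁻¹' {s S i} with hE
  have hEm : ∀ S, MeasurableSet (E S) := fun S =>
    MeasurableSet.iInter fun i => (hY i).measurable (measurableSet_singleton _)
  have hEμ : ∀ S, μ.real (E S) = 1 / 2 ^ n := by
    intro S
    have : μ (E S) = ∏ i, μ (Y i ⁻¹' {s S i}) :=
      hind.meas_iInter fun i => ⟨_, measurableSet_singleton _, rfl⟩
    have h2 : ∀ i, μ (Y i ⁻¹' {s S i}) = 1 / 2 := by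
      intro i
      by_cases hi : i ∈ S
      · simp only [hs, hi, if_true]; exact (hY i).prob_one
      · simp only [hs, hi, if_false]; exact (hY i).prob_neg_one
    rw [Measure.real, this, Finset.prod_congr rfl fun i _ => h2 i]
    simp
  have hdisj : ∀ S T, S ≠ T → Disjoint (E S) (E T) := by
    intro S T hST
    rw [Set.disjoint_left]
    intro ω h1 h2
    refine hST (Finset.ext fun i => ?_)
    have h1 := Set.mem_iInter.mp h1 i
    have h2 := Set.mem_iInter.mp h2 i
    simp only [hs, Set.mem_preimage, Set.mem_singleton_iff] at h1 h2
    rw [h1] at h2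
    by_cases hi : i ∈ S <;> by_cases hi' : i ∈ T <;> simp [hi, hi'] at h2 ⊢ <;> norm_num at h2
  have hval : ∀ S, ∀ ω ∈ E S, Z ω = 2 * S.card - n := by
    intro S ω hω
    have h1 : ∀ i, Y i ω = 2 * (if i ∈ S then 1 else 0) - 1 := fun i => by
      have : Y i ω = s S i := Set.mem_iInter.mp hω i
      rw [this, hs]
      dsimp only
      split_ifs <;> norm_num
    rw [hZ, Finset.sum_congr rfl fun i _ => h1 i, Finset.sum_sub_distrib, ← Finset.mul_sum]
    simp
  set F : Finset (Finset (Fin n)) := Finset.univ.filter fun S => S.card ∈ J with hF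
  have hsub : (⋃ S ∈ F, E S) ⊆ {ω | t ≤ Z ω} := by
    intro ω hω
    simp only [Set.mem_iUnion] at hω
    obtain ⟨S, hS, hω⟩ := hω
    rw [Set.mem_ofPred_eq, hval S ω hω]
    exact hJ _ (Finset.mem_filter.mp hS).2
  have hmeas : μ.real (⋃ S ∈ F, E S) = ∑ S ∈ F, μ.real (E S) :=
    measureReal_biUnion_finset (fun S _ T _ hST => hdisj S T hST) fun S _ => hEm S
  refine le_trans (le_of_eq ?_) (measureReal_mono hsub)
  rw [hmeas, Finset.sum_congr rfl fun S _ => hEμ S,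
    ← Finset.sum_fiberwise_of_maps_to (g := Finset.card) (t := J)
      fun S hS => (Finset.mem_filter.mp hS).2]
  refine Finset.sum_congr rfl fun j hj => ?_
  have : F.filter (fun S => S.card = j) = Finset.powersetCard j Finset.univ := by
    ext S
    simp only [hF, Finset.mem_filter, Finset.mem_univ, true_and, Finset.mem_powersetCard,
      Finset.subset_univ]
    exact ⟨fun h => h.2, fun h => ⟨h ▸ hj, h⟩⟩
  rw [this, Finset.sum_const, Finset.card_powersetCard]
  simp [div_eq_mul_inv]

end IsSymmetricRandomWalk

/-! ### Maxima of finitely many random variables. -/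

section Maximum

variable {Ω : Type*} [MeasurableSpace Ω] {μ : Measure Ω} {d : ℕ} {Z : Fin d → Ω → ℝ}

lemma integrable_iSup_fin (hd : 0 < d) (hm : ∀ i, Measurable (Z i)) (hi : ∀ i, Integrable (Z i) μ) :
    Integrable (fun ω => ⨆ i, Z i ω) μ := by
  have : Nonempty (Fin d) := ⟨⟨0, hd⟩⟩
  refine Integrable.mono' (integrable_finsetSum Finset.univ fun i _ => (hi i).abs)
    (Measurable.iSup hm).aestronglyMeasurable (Eventually.of_forall fun ω => ?_)
  obtain ⟨i, hi⟩ := exists_eq_ciSup_of_finite (f := fun i => Z i ω)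
  rw [← hi, Real.norm_eq_abs]
  exact Finset.single_le_sum (f := fun i => |Z i ω|) (fun _ _ => abs_nonneg _) (Finset.mem_univ i)

lemma integral_le_integral_iSup (hm : ∀ i, Measurable (Z i)) (hi : ∀ i, Integrable (Z i) μ)
    (i : Fin d) : ∫ ω, Z i ω ∂μ ≤ ∫ ω, (⨆ i, Z i ω) ∂μ :=
  integral_mono (hi i) (integrable_iSup_fin (Fin.pos i) hm hi) fun ω =>
    le_ciSup (f := fun i => Z i ω) (Set.finite_range _).bddAbove i

/-- Independent variables that each reach `t` with probability at least `p` have a maximum that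
reaches `t` with probability at least `1 - exp (-(p d))`. -/
lemma one_sub_exp_le_measureReal_iSup [IsProbabilityMeasure μ] (hd : 0 < d)
    (hm : ∀ i, Measurable (Z i)) (hind : iIndepFun Z μ) {t p : ℝ} (hp : ∀ i, p ≤ μ.real {ω | t ≤ Z i ω}) :
    1 - Real.exp (-(p * d)) ≤ μ.real {ω | t ≤ ⨆ i, Z i ω} := by
  have : Nonempty (Fin d) := ⟨⟨0, hd⟩⟩
  have hms : MeasurableSet {ω | t ≤ ⨆ i, Z i ω} := measurableSet_le measurable_const (.iSup hm)
  have hc : {ω | t ≤ ⨆ i, Z i ω}ᶜ ⊆ ⋂ i, Z i ⁻¹' Set.Iio t := by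
    intro ω hω
    simp only [Set.mem_compl_iff, Set.mem_ofPred_eq, not_le] at hω
    exact Set.mem_iInter.mpr fun i =>
      (le_ciSup (f := fun i => Z i ω) (Set.finite_range _).bddAbove i).trans_lt hω
  have hprod : μ (⋂ i, Z i ⁻¹' Set.Iio t) = ∏ i, μ (Z i ⁻¹' Set.Iio t) :=
    hind.meas_iInter fun i => ⟨_, measurableSet_Iio, rfl⟩
  have hle : μ.real (⋂ i, Z i ⁻¹' Set.Iio t) ≤ Real.exp (-(p * d)) := by
    rw [Measure.real, hprod, ENNReal.toReal_prod]
    calc ∏ i, (μ (Z i ⁻¹' Set.Iio t)).toReal ≤ ∏ _i : Fin d, Real.exp (-p) := by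
          refine Finset.prod_le_prod (fun _ _ => ENNReal.toReal_nonneg) fun i _ => ?_
          have h1 : Z i ⁻¹' Set.Iio t = {ω | t ≤ Z i ω}ᶜ := by ext ω; simp
          have h2 := probReal_compl_eq_one_sub (μ := μ)
            (measurableSet_le measurable_const (hm i) : MeasurableSet {ω | t ≤ Z i ω})
          rw [Measure.real, ← h1] at h2
          rw [h2]
          linarith [hp i, Real.add_one_le_exp (-p)]
      _ = Real.exp (-(p * d)) := by
          rw [Finset.prod_const, ← Real.exp_nat_mul]
          simp [mul_comm]
  have h3 := probReal_compl_eq_one_sub (μ := μ) hms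
  have h4 := measureReal_mono (μ := μ) hc
  linarith

lemma mul_measureReal_sub_le_integral_iSup [IsProbabilityMeasure μ]
    (hm : ∀ i, Measurable (Z i)) (hi : ∀ i, Integrable (Z i) μ) {t : ℝ} (i : Fin d) :
    t * μ.real {ω | t ≤ ⨆ i, Z i ω} - ∫ ω, |Z i ω| ∂μ ≤ ∫ ω, (⨆ i, Z i ω) ∂μ := by
  have hms : MeasurableSet {ω | t ≤ ⨆ i, Z i ω} := measurableSet_le measurable_const (.iSup hm)
  have hint : Integrable (Set.indicator {ω | t ≤ ⨆ i, Z i ω} fun _ => t) μ :=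
    (integrable_const t).indicator hms
  have h1 : ∫ ω, Set.indicator {ω | t ≤ ⨆ i, Z i ω} (fun _ => t) ω ∂μ =
      t * μ.real {ω | t ≤ ⨆ i, Z i ω} := by
    rw [integral_indicator hms]; simp [mul_comm]
  rw [← h1, ← integral_sub hint (hi i).abs]
  refine integral_mono (hint.sub (hi i).abs) (integrable_iSup_fin (Fin.pos i) hm hi) fun ω => ?_
  have hle : Z i ω ≤ ⨆ i, Z i ω := le_ciSup (f := fun i => Z i ω) (Set.finite_range _).bddAbove i
  show Set.indicator {ω | t ≤ ⨆ i, Z i ω} (fun _ => t) ω - |Z i ω| ≤ ⨆ i, Z i ω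
  -- Off the event, the maximum is still at least `Z i ≥ -|Z i|`; no sign of `t` is needed.
  by_cases hω : t ≤ ⨆ i, Z i ω
  · rw [Set.indicator_of_mem (by exact hω)]
    linarith [abs_nonneg (Z i ω)]
  · rw [Set.indicator_of_notMem (by exact hω)]
    linarith [neg_abs_le (Z i ω)]

end Maximum

/-! ### Numerical estimates in `l = ln d`. -/

section Estimates

variable {l : ℝ}

lemma one_le_sqrt_sub_log (hl : 0 < l) : 1 ≤ √(2 * l - 2 * Real.log l) :=
  Real.one_le_sqrt.mpr (by linarith [Real.log_le_sub_one_of_pos hl])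

lemma sqrt_le_sqrt_sub_log (hl : 0 < l) : √l ≤ √(2 * l - 2 * Real.log l) := by
  have h := Real.log_le_sub_one_of_pos (half_pos hl)
  rw [Real.log_div hl.ne' two_ne_zero] at h
  exact Real.sqrt_le_sqrt (by linarith [Real.log_two_lt_d9])

lemma sqrt_sub_log_le (hl : 1 ≤ l) : √(2 * l - 2 * Real.log l) ≤ √2 * √l := by
  rw [← Real.sqrt_mul zero_le_two]
  exact Real.sqrt_le_sqrt (by linarith [Real.log_nonneg hl])

lemma sqrt_two_mul_pi_bounds : 2.5 ≤ √(2 * Real.pi) ∧ √(2 * Real.pi) ≤ 2.51 := by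
  constructor
  · exact Real.le_sqrt_of_sq_le (by linarith [Real.pi_gt_d2])
  · exact Real.sqrt_le_iff.mpr ⟨by norm_num, by linarith [Real.pi_lt_d2]⟩

lemma one_sub_exp_neg_le (l : ℝ) :
    1 - Real.exp (-(√l / (3.1 * √(2 * Real.pi)))) ≤ √l / 7.75 := by
  have h := Real.add_one_le_exp (-(√l / (3.1 * √(2 * Real.pi))))
  have h2 : √l / (3.1 * √(2 * Real.pi)) ≤ √l / 7.75 := by
    gcongr
    linarith [sqrt_two_mul_pi_bounds.1]
  linarith

lemma one_sub_exp_neg_nonneg (l : ℝ) :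
    0 ≤ 1 - Real.exp (-(√l / (3.1 * √(2 * Real.pi)))) := by
  rw [sub_nonneg, Real.exp_le_one_iff, neg_nonpos]
  positivity

lemma one_sub_exp_neg_ge (hl : 11 ≤ √l) :
    0.5 ≤ 1 - Real.exp (-(√l / (3.1 * √(2 * Real.pi)))) := by
  have h1 : 1 ≤ √l / (3.1 * √(2 * Real.pi)) := by
    rw [le_div_iff₀ (by positivity)]
    linarith [sqrt_two_mul_pi_bounds.2]
  have h2 : Real.exp (-(√l / (3.1 * √(2 * Real.pi)))) ≤ Real.exp (-1) :=
    Real.exp_le_exp.mpr (by linarith)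
  linarith [Real.exp_neg_one_lt_d9]

/-- The first factor is at most `2.5 / 7.75` and the second at most `3`. Since `R ≥ 1`, this makes
the claimed bound nonpositive for small `d`. -/
lemma one_sub_exp_mul_sqrt_sub_log_le (hl : 0.69 ≤ l) (hl' : l ≤ 6.25) :
    (1 - Real.exp (-(√l / (3.1 * √(2 * Real.pi))))) * (√(2 * l - 2 * Real.log l) - 1) ≤ 1 := by
  have hA := one_le_sqrt_sub_log (l := l) (by linarith)
  refine (mul_le_mul_of_nonneg_right (one_sub_exp_neg_le l) (by linarith)).trans ?_
  have hs : √l ≤ 2.5 := Real.sqrt_le_iff.mpr ⟨by norm_num, by linarith⟩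
  have h2 : √(2 : ℝ) ≤ 1.42 := Real.sqrt_le_iff.mpr ⟨by norm_num, by norm_num⟩
  have hA' : √(2 * l - 2 * Real.log l) ≤ 4 := by
    rcases le_total 1 l with h1 | h1
    · nlinarith [sqrt_sub_log_le h1, Real.sqrt_nonneg l, Real.sqrt_nonneg (2 : ℝ)]
    · have := Real.one_sub_inv_le_log_of_pos (show 0 < l by linarith)
      have h3 : l⁻¹ ≤ 2 := inv_le_of_inv_le₀ (by norm_num) (by linarith)
      exact Real.sqrt_le_iff.mpr ⟨by norm_num, by linarith⟩
  calc √l / 7.75 * (√(2 * l - 2 * Real.log l) - 1) ≤ 2.5 / 7.75 * (4 - 1) := by gcongr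
    _ ≤ 1 := by norm_num

end Estimates

/-! ### The lower bound for admissible `n` and `d`. -/

section Parameters

variable {n d : ℕ}

lemma log_ge_of_two_le (hd : 2 ≤ d) : 0.69 ≤ Real.log d :=
  le_trans (by linarith [Real.log_two_gt_d9])
    (Real.log_le_log two_pos (by exact_mod_cast hd : (2 : ℝ) ≤ d))

lemma log_le_of_le_exp (hd : 2 ≤ d) (hdn : (d : ℝ) ≤ Real.exp ((n : ℝ) / 3)) :
    Real.log d ≤ n / 3 :=
  (Real.log_le_iff_le_exp (by positivity)).mpr hdn

lemma klRatio_arg_le (hn : 0 < n) (h : Real.log d ≤ n / 3) :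
    1.6 * √(Real.log d) / (2 * √n) ≤ 0.462 := by
  have hn' : (0 : ℝ) < n := by exact_mod_cast hn
  rw [div_le_iff₀ (by positivity)]
  have h1 : √(Real.log d) ≤ √((0.5775 * √n) ^ 2) := Real.sqrt_le_sqrt (by
    rw [mul_pow, Real.sq_sqrt hn'.le]
    linarith)
  rw [Real.sqrt_sq (by positivity)] at h1
  linarith [Real.sqrt_nonneg (n : ℝ)]

lemma sqrt_klRatio_bounds (hn : 0 < n) (h : Real.log d ≤ n / 3) :
    1 ≤ √(klRatio (1.6 * √(Real.log d) / (2 * √n))) ∧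
      √(klRatio (1.6 * √(Real.log d) / (2 * √n))) ≤ 1.3 := by
  have h0 : 0 ≤ 1.6 * √(Real.log d) / (2 * √n) := by positivity
  have h1 := klRatio_arg_le hn h
  exact ⟨Real.one_le_sqrt.mpr (one_le_klRatio (by rw [abs_of_nonneg h0]; linarith)),
    Real.sqrt_le_iff.mpr ⟨by norm_num, (klRatio_le h0 h1).trans (by norm_num)⟩⟩

lemma walkMaxLowerBound_eq (n d : ℕ) :
    walkMaxLowerBound n d = √n * ((1 - Real.exp (-(√(Real.log d) / (3.1 * √(2 * Real.pi))))) *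
      (√(2 * Real.log d - 2 * Real.log (Real.log d)) - 1) /
        √(klRatio (1.6 * √(Real.log d) / (2 * √n))) - 1) := by
  unfold walkMaxLowerBound
  ring

lemma walkMaxLowerBound_nonpos (hn : 0 < n) (hd : 2 ≤ d) (h : Real.log d ≤ n / 3)
    (hl : Real.log d ≤ 6.25) : walkMaxLowerBound n d ≤ 0 := by
  rw [walkMaxLowerBound_eq]
  refine mul_nonpos_of_nonneg_of_nonpos (Real.sqrt_nonneg _) (sub_nonpos.mpr ?_)
  have hR := (sqrt_klRatio_bounds hn h).1
  rw [div_le_one (by linarith)]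
  exact (one_sub_exp_mul_sqrt_sub_log_le (log_ge_of_two_le hd) hl).trans hR

lemma walkMaxLowerBound_ge (hn : 0 < n) (hd : 2 ≤ d) (h : Real.log d ≤ n / 3) :
    0.09 * √((n : ℝ) * Real.log d) - 2 * √(n : ℝ) ≤ walkMaxLowerBound n d := by
  have hl : 0 < Real.log d := by linarith [log_ge_of_two_le hd]
  obtain ⟨hR, hR'⟩ := sqrt_klRatio_bounds hn h
  have hA := one_le_sqrt_sub_log hl
  have hA' := sqrt_le_sqrt_sub_log hl
  have hc := one_sub_exp_neg_nonneg (Real.log d)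
  rw [walkMaxLowerBound_eq, Real.sqrt_mul (Nat.cast_nonneg n)]
  have key : 0.09 * √(Real.log d) - 1 ≤
      (1 - Real.exp (-(√(Real.log d) / (3.1 * √(2 * Real.pi))))) *
      (√(2 * Real.log d - 2 * Real.log (Real.log d)) - 1) /
        √(klRatio (1.6 * √(Real.log d) / (2 * √n))) := by
    rw [le_div_iff₀ (by linarith)]
    -- Up to `11` the left side is nonpositive, as `0.09 · 11 < 1`; beyond it the exponential factor
    -- is at least `1/2`, which beats `0.09 R ≤ 0.117`.
    rcases le_total (√(Real.log d)) 11 with hs | hs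
    · refine le_trans ?_ (mul_nonneg hc (by linarith))
      exact mul_nonpos_of_nonpos_of_nonneg (by linarith) (by linarith)
    · have hc' := one_sub_exp_neg_ge hs
      nlinarith
  nlinarith [Real.sqrt_nonneg (n : ℝ)]

/-- Number of integers `j` with `a ≤ j ≤ b`. -/
lemma sub_one_le_card_Icc_ceil_floor {a b : ℝ} (ha : 0 ≤ a) :
    b - a - 1 ≤ (Finset.Icc ⌈a⌉₊ ⌊b⌋₊).card := by
  rw [Nat.card_Icc]
  have h1 := Nat.ceil_lt_add_one ha
  have h2 := Nat.lt_floor_add_one b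
  have h3 : ((⌊b⌋₊ : ℝ) + 1) - ⌈a⌉₊ ≤ ((⌊b⌋₊ + 1 - ⌈a⌉₊ : ℕ) : ℝ) := by
    have : ⌊b⌋₊ + 1 ≤ (⌊b⌋₊ + 1 - ⌈a⌉₊) + ⌈a⌉₊ := le_tsub_add
    have : ((⌊b⌋₊ : ℝ) + 1) ≤ ((⌊b⌋₊ + 1 - ⌈a⌉₊ : ℕ) : ℝ) + ⌈a⌉₊ := by exact_mod_cast this
    linarith
  linarith

/-- Near the threshold, every head count has probability at least of order `log d / (d √n)`. -/
lemma choose_div_two_pow_ge_log_div (hn : 0 < n) (hd : 2 ≤ d) (h : Real.log d ≤ n / 3)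
    (hl : 1 ≤ Real.log d) {j : ℕ} (hj0 : 0 ≤ 2 * (j : ℝ) - n)
    (hj : 2 * (j : ℝ) - n ≤ √n * √(2 * Real.log d - 2 * Real.log (Real.log d)) /
      √(klRatio (1.6 * √(Real.log d) / (2 * √n)))) :
    2 * √(2 * Real.pi) / (Real.exp 1 ^ 2 * √n) * (Real.log d / d) ≤ n.choose j / 2 ^ n := by
  obtain ⟨hR, hR'⟩ := sqrt_klRatio_bounds hn h
  have hx0 := klRatio_arg_le hn h
  have hn' : (0 : ℝ) < n := by exact_mod_cast hn
  have hN : 0 < √(n : ℝ) := Real.sqrt_pos.mpr hn'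
  have hNN := Real.mul_self_sqrt hn'.le
  set x₀ := 1.6 * √(Real.log d) / (2 * √n) with hx₀
  set x : ℝ := (2 * j - n) / (2 * n) with hx
  have hxnn : 0 ≤ x := by positivity
  have hAle : √(2 * Real.log d - 2 * Real.log (Real.log d)) ≤ 1.6 * √(Real.log d) := by
    refine (sqrt_sub_log_le hl).trans (mul_le_mul_of_nonneg_right ?_ (Real.sqrt_nonneg _))
    exact Real.sqrt_le_iff.mpr ⟨by norm_num, by norm_num⟩
  have hj' : 2 * (j : ℝ) - n ≤ √n * √(2 * Real.log d - 2 * Real.log (Real.log d)) :=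
    hj.trans (div_le_self (by positivity) hR)
  -- The constant `1.6` exceeds `√2`, so every deviation in range lies below `x₀`, where `ψ` is
  -- evaluated.
  have hxx₀ : x ≤ x₀ := by
    rw [hx, hx₀, div_le_div_iff₀ (by positivity) (by positivity)]
    calc (2 * (j : ℝ) - n) * (2 * √n) ≤ (√n * (1.6 * √(Real.log d))) * (2 * √n) := by
          gcongr; exact hj'.trans (by gcongr)
      _ = 1.6 * √(Real.log d) * (2 * (√n * √n)) := by ring
      _ = _ := by rw [hNN]
  have hjn : (j : ℝ) / n = 1 / 2 + x := by rw [hx]; field_simp; ring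
  have hjpos : 0 < j := by
    have : (0 : ℝ) < j := by linarith
    exact_mod_cast this
  have hjlt : j < n := by
    have h1 : x ≤ 0.462 := hxx₀.trans hx0
    rw [hx, div_le_iff₀ (by positivity)] at h1
    have : (j : ℝ) < n := by linarith
    exact_mod_cast this
  refine le_trans ?_ (choose_div_two_pow_ge hjpos hjlt)
  refine mul_le_mul_of_nonneg_left ?_ (by positivity)
  have hd0 : (0 : ℝ) < d := by positivity
  have hexp : Real.log d / d = Real.exp (-(Real.log d - Real.log (Real.log d))) := by
    rw [neg_sub, Real.exp_sub, Real.exp_log (by linarith), Real.exp_log hd0]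
  rw [hexp, Real.exp_le_exp, neg_le_neg_iff, hjn, ← klRatio_mul_sq]
  -- Dividing the threshold by `R` cancels `ψ(x₀)`, so the exponent `n · 2x² ψ(x)` is at most `ln d
  -- - ln ln d`.
  have hψ : klRatio x ≤ klRatio x₀ := klRatio_le_of_le hxnn hxx₀ (by linarith)
  have hψ1 : 0 < klRatio x₀ := Real.sqrt_pos.mp (by linarith)
  have hA2 : 0 ≤ 2 * Real.log d - 2 * Real.log (Real.log d) := by
    linarith [Real.log_le_sub_one_of_pos (show 0 < Real.log d by linarith)]
  have hsq : (2 * (j : ℝ) - n) ^ 2 ≤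
      n * (2 * Real.log d - 2 * Real.log (Real.log d)) / klRatio x₀ := by
    refine (pow_le_pow_left₀ hj0 hj 2).trans_eq ?_
    rw [div_pow, mul_pow, Real.sq_sqrt hn'.le, Real.sq_sqrt hA2, Real.sq_sqrt hψ1.le]
  rw [le_div_iff₀ hψ1] at hsq
  calc (n : ℝ) * (klRatio x * (2 * x ^ 2)) ≤ n * (klRatio x₀ * (2 * x ^ 2)) := by gcongr
    _ = (2 * (j : ℝ) - n) ^ 2 * klRatio x₀ / (2 * n) := by rw [hx]; field_simp
    _ ≤ n * (2 * Real.log d - 2 * Real.log (Real.log d)) / (2 * n) := by gcongr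
    _ = _ := by field_simp

lemma IsSymmetricRandomWalk.tail_ge {Ω : Type*} [MeasurableSpace Ω] {μ : Measure Ω}
    [IsProbabilityMeasure μ] {Z : Ω → ℝ} (hZ : IsSymmetricRandomWalk μ n Z) (hn : 0 < n)
    (hd : 2 ≤ d) (h : Real.log d ≤ n / 3) (hl : 6.25 ≤ Real.log d) :
    √(Real.log d) / (3.1 * √(2 * Real.pi)) / d ≤ μ.real {ω | √n *
      (√(2 * Real.log d - 2 * Real.log (Real.log d)) - 1) /
        √(klRatio (1.6 * √(Real.log d) / (2 * √n))) ≤ Z ω} := by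
  obtain ⟨hR, hR'⟩ := sqrt_klRatio_bounds hn h
  have hA := one_le_sqrt_sub_log (show 0 < Real.log d by linarith)
  have hch := fun j : ℕ => choose_div_two_pow_ge_log_div (j := j) hn hd h (by linarith)
  set R := √(klRatio (1.6 * √(Real.log d) / (2 * √n)))
  set A := √(2 * Real.log d - 2 * Real.log (Real.log d))
  set T := √n * (A - 1) / R with hT
  set B := √n * A / R with hB
  have hN : 4.33 ≤ √(n : ℝ) := Real.le_sqrt_of_sq_le (by linarith)
  have hT0 : 0 ≤ T := div_nonneg (mul_nonneg (by linarith) (by linarith)) (by linarith)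
  set J := Finset.Icc ⌈(n + T) / 2⌉₊ ⌊(n + B) / 2⌋₊ with hJ
  have hB0 : 0 ≤ B := by positivity
  have hmem : ∀ j ∈ J, T ≤ 2 * (j : ℝ) - n ∧ 2 * (j : ℝ) - n ≤ B := by
    intro j hj
    rw [hJ, Finset.mem_Icc, Nat.ceil_le, Nat.le_floor_iff (by positivity)] at hj
    constructor <;> linarith [hj.1, hj.2]
  refine le_trans ?_ (hZ.sum_choose_le_measureReal fun j hj => (hmem j hj).1)
  -- The window has length `√n / (2R) ≥ √n / 2.6`; the possible loss of one integer is absorbed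
  -- because `√n ≥ 4.33`.
  have hcard : √n * 0.153 ≤ (J.card : ℝ) := by
    have h1 := sub_one_le_card_Icc_ceil_floor (a := (n + T) / 2) (b := (n + B) / 2) (by positivity)
    have h2 : (n + B) / 2 - (n + T) / 2 = √n / (2 * R) := by
      rw [hB, hT]; field_simp; ring
    have h3 : √(n : ℝ) / 2.6 ≤ √n / (2 * R) := by gcongr; linarith
    rw [h2] at h1
    have h4 : √(n : ℝ) * 0.153 ≤ √n / 2.6 - 1 := by
      rw [div_eq_mul_inv]
      norm_num
      linarith
    exact h4.trans ((sub_le_sub_right h3 1).trans h1)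
  have hs : 2.5 ≤ √(Real.log d) := Real.le_sqrt_of_sq_le (by linarith)
  have hd0 : (0 : ℝ) < d := by positivity
  have hE2 : Real.exp 1 ^ 2 ≤ 7.4 := by
    have := Real.exp_one_lt_d9
    nlinarith [Real.exp_pos 1]
  obtain ⟨hP, -⟩ := sqrt_two_mul_pi_bounds
  calc √(Real.log d) / (3.1 * √(2 * Real.pi)) / d
      ≤ √n * 0.153 * (2 * √(2 * Real.pi) / (Real.exp 1 ^ 2 * √n) * (Real.log d / d)) := by
        have hne : √(n : ℝ) ≠ 0 := by linarith
        have : √n * 0.153 * (2 * √(2 * Real.pi) / (Real.exp 1 ^ 2 * √n) * (Real.log d / d)) =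
            0.306 * √(2 * Real.pi) * (√(Real.log d) * √(Real.log d)) / Real.exp 1 ^ 2 / d := by
          rw [Real.mul_self_sqrt (by linarith)]
          field_simp
          norm_num
        rw [this]
        refine div_le_div_of_nonneg_right ?_ hd0.le
        rw [div_le_div_iff₀ (by positivity) (by positivity)]
        -- What remains is `e² ≤ 0.306 · 3.1 · 2π · √(ln d)`, ample since `√(ln d) ≥ 2.5`.
        have h4 : 6.25 ≤ √(2 * Real.pi) * √(2 * Real.pi) := by nlinarith
        have h5 : 15.6 ≤ √(2 * Real.pi) * √(2 * Real.pi) * √(Real.log d) := by nlinarith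
        nlinarith
    _ ≤ J.card * (2 * √(2 * Real.pi) / (Real.exp 1 ^ 2 * √n) * (Real.log d / d)) := by
        gcongr
    _ ≤ ∑ j ∈ J, (n.choose j / 2 ^ n : ℝ) := by
        rw [← nsmul_eq_mul]
        exact Finset.card_nsmul_le_sum _ _ _ fun j hj =>
          hch j (hT0.trans (hmem j hj).1) (hmem j hj).2

theorem walkMaxLowerBound_le_integral_iSup {Ω : Type*} [MeasurableSpace Ω] {μ : Measure Ω}
    [IsProbabilityMeasure μ] (hn : 0 < n) (hd : 2 ≤ d) (h : Real.log d ≤ n / 3)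
    {Z : Fin d → Ω → ℝ} (hZ : ∀ i, IsSymmetricRandomWalk μ n (Z i)) (hind : iIndepFun Z μ) :
    walkMaxLowerBound n d ≤ ∫ ω, (⨆ i, Z i ω) ∂μ := by
  have hm := fun i => (hZ i).measurable
  have hi := fun i => (hZ i).integrable
  have hd0 : 0 < d := by omega
  let i₀ : Fin d := ⟨0, hd0⟩
  rcases le_total (Real.log d) 6.25 with hl | hl
  · refine (walkMaxLowerBound_nonpos hn hd h hl).trans ?_
    rw [← (hZ i₀).integral_eq_zero]
    exact integral_le_integral_iSup hm hi i₀
  · have h1 := one_sub_exp_le_measureReal_iSup hd0 hm hind fun i => (hZ i).tail_ge hn hd h hl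
    rw [div_mul_cancel₀ _ (by positivity)] at h1
    refine le_trans ?_ (mul_measureReal_sub_le_integral_iSup hm hi (t := √n *
      (√(2 * Real.log d - 2 * Real.log (Real.log d)) - 1) /
        √(klRatio (1.6 * √(Real.log d) / (2 * √n)))) i₀)
    have hA := one_le_sqrt_sub_log (show 0 < Real.log d by linarith)
    have h2 := (hZ i₀).integral_abs_le hn
    have h3 := mul_le_mul_of_nonneg_left h1 (show 0 ≤ √n *
      (√(2 * Real.log d - 2 * Real.log (Real.log d)) - 1) /
        √(klRatio (1.6 * √(Real.log d) / (2 * √n))) from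
      div_nonneg (mul_nonneg (Real.sqrt_nonneg _) (by linarith)) (Real.sqrt_nonneg _))
    refine le_trans (le_of_eq ?_) (sub_le_sub h3 h2)
    unfold walkMaxLowerBound
    ring

end Parameters

/-! ### Asymptotics and conclusion. -/

lemma tendsto_walkMaxLowerBound_div {d : ℕ} (hd : 2 ≤ d) :
    Tendsto (fun n : ℕ => walkMaxLowerBound n d / √(2 * (n : ℝ) * Real.log d)) atTop
      (𝓝 (((1 - Real.exp (-(√(Real.log d) / (3.1 * √(2 * Real.pi))))) *
        (√(2 * Real.log d - 2 * Real.log (Real.log d)) - 1) - 1) / √(2 * Real.log d))) := by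
  have hl : 0 < Real.log d := by linarith [log_ge_of_two_le hd]
  have hs : Tendsto (fun n : ℕ => 2 * √(n : ℝ)) atTop atTop :=
    (Real.tendsto_sqrt_atTop.comp tendsto_natCast_atTop_atTop).const_mul_atTop two_pos
  have hψ : Tendsto (fun n : ℕ => √(klRatio (1.6 * √(Real.log d) / (2 * √n)))) atTop (𝓝 1) := by
    have := (tendsto_klRatio_zero.comp (hs.const_div_atTop (1.6 * √(Real.log d)))).sqrt
    rwa [Real.sqrt_one] at this
  have := ((tendsto_const_nhds (x := (1 - Real.exp (-(√(Real.log d) / (3.1 * √(2 * Real.pi))))) *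
    (√(2 * Real.log d - 2 * Real.log (Real.log d)) - 1))).div hψ one_ne_zero).sub_const 1
      |>.div_const (√(2 * Real.log d))
  rw [div_one] at this
  refine this.congr' ?_
  filter_upwards [eventually_gt_atTop 0] with n hn
  have hn' : 0 < √(n : ℝ) := Real.sqrt_pos.mpr (by exact_mod_cast hn)
  rw [walkMaxLowerBound_eq, show 2 * (n : ℝ) * Real.log d = n * (2 * Real.log d) by ring,
    Real.sqrt_mul (Nat.cast_nonneg n), mul_div_mul_left _ _ hn'.ne']
  rfl

lemma tendsto_limit_ratio_atTop :
    Tendsto (fun l : ℝ => ((1 - Real.exp (-(√l / (3.1 * √(2 * Real.pi))))) *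
        (√(2 * l - 2 * Real.log l) - 1) - 1) / √(2 * l)) atTop (𝓝 1) := by
  have hc : Tendsto (fun l : ℝ => 1 - Real.exp (-(√l / (3.1 * √(2 * Real.pi))))) atTop (𝓝 1) := by
    have h1 : Tendsto (fun l : ℝ => √l / (3.1 * √(2 * Real.pi))) atTop atTop :=
      Real.tendsto_sqrt_atTop.atTop_div_const (by positivity)
    simpa using (Real.tendsto_exp_neg_atTop_nhds_zero.comp h1).const_sub 1
  have hinv : Tendsto (fun l : ℝ => (√(2 * l))⁻¹) atTop (𝓝 0) :=
    (Real.tendsto_sqrt_atTop.comp (tendsto_id.const_mul_atTop two_pos)).inv_tendsto_atTop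
  -- This is `√(2l - 2 ln l) / √(2l)`; every other term carries a vanishing factor `1 / √(2l)`.
  have hA : Tendsto (fun l : ℝ => √(1 - Real.log l / l)) atTop (𝓝 1) := by
    simpa using (Real.isLittleO_log_id_atTop.tendsto_div_nhds_zero.const_sub 1).sqrt
  have := ((hc.mul (hA.sub hinv)).sub hinv)
  simp only [sub_zero, mul_one] at this
  refine this.congr' ?_
  filter_upwards [eventually_gt_atTop 0] with l hl
  have h0 : √(2 * l) ≠ 0 := by positivity
  have h1 : √(1 - Real.log l / l) = √(2 * l - 2 * Real.log l) / √(2 * l) := by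
    rw [← Real.sqrt_div' _ (by positivity)]
    congr 1
    field_simp
  rw [h1]
  field_simp

theorem mainTheorem1 :
    (∀ {Ω : Type*} [MeasurableSpace Ω] (μ : Measure Ω) [IsProbabilityMeasure μ]
      (n d : ℕ) (_hn : 7 ≤ n) (_hd : 2 ≤ d) (_hdn : (d : ℝ) ≤ Real.exp ((n : ℝ) / 3))
      (Z : Fin d → Ω → ℝ) (_hZ : ∀ i, IsSymmetricRandomWalk μ n (Z i)) (_hind : iIndepFun Z μ),
      (∫ ω, (⨆ i, Z i ω) ∂μ) ≥ walkMaxLowerBound n d ∧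
      walkMaxLowerBound n d ≥ 0.09 * √((n : ℝ) * Real.log d) - 2 * √(n : ℝ)) ∧
    (∃ g : ℕ → ℝ,
      (∀ d : ℕ, 2 ≤ d →
        Tendsto (fun n : ℕ => walkMaxLowerBound n d / √(2 * (n : ℝ) * Real.log d))
          atTop (𝓝 (g d))) ∧
      Tendsto g atTop (𝓝 1)) := by
  -- Unification supplies `g`; it depends on `d` only through `ln d`, so the outer limit is one over
  -- real `l`.
  refine ⟨?_, _, fun d hd => tendsto_walkMaxLowerBound_div hd,
    tendsto_limit_ratio_atTop.comp (Real.tendsto_log_atTop.comp tendsto_natCast_atTop_atTop)⟩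
  intro Ω _ μ _ n d hn hd hdn Z hZ hind
  have h := log_le_of_le_exp hd hdn
  exact ⟨walkMaxLowerBound_le_integral_iSup (by omega) hd h hZ hind,
    walkMaxLowerBound_ge (by omega) hd h⟩
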